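/- All vector spaces are over a field $K$ of characteristic zero; in exponents of $-1$ a homogeneous element stands for its degree. For a $\mathbb Z$-graded vector space $V$, homogeneous $v_1,\dots,v_n\in V$ and $\sigma\in\mathbb S_n$, the Koszul sign $\varepsilon(\sigma)=\varepsilon(\sigma;v_1,\dots,v_n)$ is the sign in $v_1\odot\cdots\odot v_n=\varepsilon(\sigma)\,v_{\sigma(1)}\odot\cdots\odot v_{\sigma(n)}$ in the graded symmetric algebra $S(V)$; $\mathbb S_{(i_1,\dots,i_r)}$ denotes the set of $(i_1,\dots,i_r)$-shuffles (permutations increasing on each of the consecutive blocks of lengths $i_1,\dots,i_r$). A *symmetric graded Lie algebra* is a $\mathbb Z$-graded vector space $\mathfrak g$ with a bilinear bracket of degree $1$ such that, for homogeneous $x,y,z$, $[x,y]=(-1)^{xy}[y,x]$ and $[x,[y,z]]=(-1)^{x+1}[[x,y],z]+(-1)^{(x+1)(y+1)}[y,[x,z]]$. An *action* of $\mathfrak g$ on a $\mathbb Z$-graded vector space $V$ is a linear map $\rho:\mathfrak g\to\mathfrak{gl}(V)$ of degree $1$ such that $\rho([x,y])=(-1)^{x+1}\big(\rho(x)\rho(y)-(-1)^{(x+1)(y+1)}\rho(y)\rho(x)\big)$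 for homogeneous $x,y$ (equivalently, $s^{-1}\circ\rho$ is a homomorphism to the symmetric graded Lie algebra $s^{-1}\mathfrak{gl}(V)$). A *homotopy $\mathcal O$-operator of weight $0$* on $\mathfrak g$ with respect to $\rho$ is a degree $0$ element $T=\sum_{i\ge0}T_i\in\mathrm{Hom}(S(V),\mathfrak g)$, $T_i\in\mathrm{Hom}(S^i(V),\mathfrak g)$, such that for all $p\ge0$ and all homogeneous $v_1,\dots,v_p\in V$ $$\sum_{k+l=p+1}\ \sum_{\sigma\in\mathbb S_{(l,1,p-l-1)}}\varepsilon(\sigma)\,T_{k-1}\big(\rho(T_l(v_{\sigma(1)},\dots,v_{\sigma(l)}))v_{\sigma(l+1)},v_{\sigma(l+2)},\dots,v_{\sigma(p)}\big)$$ $$=\frac12\sum_{k+l=p+1}\ \sum_{\sigma\in\mathbb S_{(k-1,l)}}\varepsilon(\sigma)\,\big[T_{k-1}(v_{\sigma(1)},\dots,v_{\sigma(k-1)}),T_l(v_{\sigma(k)},\dots,v_{\sigma(p)})\big],$$ with $0\le l\le p-1$ on the left-hand side and $0\le l\le p$ on the right-hand side. A *pre-Lie$_\infty$ algebra* is a $\mathbb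 Z$-graded vector space $V$ with linear maps $\theta_k:\otimes^kV\to V$ $(k\ge1)$ of degree $1$ such that for all $n\ge1$ and all homogeneous $v_1,\dots,v_n\in V$: (i) $\theta_n(v_1,\dots,v_{n-1},v_n)=\varepsilon(\sigma;v_1,\dots,v_{n-1})\,\theta_n(v_{\sigma(1)},\dots,v_{\sigma(n-1)},v_n)$ for every $\sigma\in\mathbb S_{n-1}$; and (ii) $$\sum_{\substack{i+j=n+1\\ i\ge1,\,j\ge2}}\ \sum_{\sigma\in\mathbb S_{(i-1,1,j-2)}}\varepsilon(\sigma)\,\theta_j\big(\theta_i(v_{\sigma(1)},\dots,v_{\sigma(i)}),v_{\sigma(i+1)},\dots,v_{\sigma(n-1)},v_n\big)$$ $$+\sum_{\substack{i+j=n+1\\ i\ge1,\,j\ge1}}\ \sum_{\sigma\in\mathbb S_{(j-1,i-1)}}(-1)^{v_{\sigma(1)}+\cdots+v_{\sigma(j-1)}}\varepsilon(\sigma)\,\theta_j\big(v_{\sigma(1)},\dots,v_{\sigma(j-1)},\theta_i(v_{\sigma(j)},\dots,v_{\sigma(n-1)},v_n)\big)=0.$$ **Corollary.** Let $T=\sum_{i\ge0}T_i\in\mathrm{Hom}^0(S(V),\mathfrak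 g)$ be a homotopy $\mathcal O$-operator of weight $0$ on a symmetric graded Lie algebra $(\mathfrak g,[\cdot,\cdot])$ with respect to an action $\rho:\mathfrak g\to\mathfrak{gl}(V)$ on a $\mathbb Z$-graded vector space $V$. Then $(V,\{\theta_k\}_{k\ge1})$ is a pre-Lie$_\infty$ algebra, where the $\theta_k:\otimes^kV\to V$ are the linear maps of degree $1$ defined by $$\theta_k(v_1,\dots,v_k)=\rho\big(T_{k-1}(v_1,\dots,v_{k-1})\big)v_k,\qquad v_1,\dots,v_k\in V.$$ -/

import Mathlib

namespace HomotopyOp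

/-! ### Koszul signs and shuffles (positions are numbered from `0`) -/

/-- The Koszul sign `ε(σ; v₁, …, vₙ)` of a permutation of homogeneous elements of degrees `d`,
i.e. the sign in `v₁ ⊙ ⋯ ⊙ vₙ = ε(σ) v_{σ(1)} ⊙ ⋯ ⊙ v_{σ(n)}`: one factor `(-1)^{d d'}` for every
pair of elements that `σ` puts out of order. -/
def koszulSign {n : ℕ} (d : Fin n → ℤ) (σ : Equiv.Perm (Fin n)) : ℤˣ :=
  ∏ i : Fin n, ∏ j : Fin n,
    if i < j ∧ σ j < σ i then (d (σ i) * d (σ j)).negOnePow else 1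

/-- `σ` is increasing on each of the consecutive blocks of positions into which the elements of
`cuts` divide `{0, …, n - 1}` (a cut `c` separates the positions `< c` from the positions `≥ c`). -/
def IsShuffle {n : ℕ} (cuts : Finset ℕ) (σ : Equiv.Perm (Fin n)) : Prop :=
  ∀ i j : Fin n, i < j → (∀ c ∈ cuts, (j : ℕ) < c ∨ c ≤ (i : ℕ)) → σ i < σ j

instance {n : ℕ} (cuts : Finset ℕ) (σ : Equiv.Perm (Fin n)) : Decidable (IsShuffle cuts σ) := by
  unfold IsShuffle; infer_instance

/-- The set of `(a, n - a)`-shuffles. -/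
def shuffles₂ (n a : ℕ) : Finset (Equiv.Perm (Fin n)) :=
  Finset.univ.filter (IsShuffle {a})

/-- The set of `(a, 1, n - a - 1)`-shuffles. -/
def shuffles₃ (n a : ℕ) : Finset (Equiv.Perm (Fin n)) :=
  Finset.univ.filter (IsShuffle {a, a + 1})

/-- The `m` consecutive entries of the tuple `u` that start at position `a`. -/
def block {α : Type*} {n : ℕ} (u : Fin n → α) (a m : ℕ) (h : a + m ≤ n) : Fin m → α :=
  fun i => u ⟨a + i, by omega⟩

/-! ### Graded objects

A `ℤ`-graded vector space is a vector space `V` with a family `𝒱 : ℤ → Submodule K V` of which it is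
the internal direct sum. -/

section Graded

variable {K : Type*} [Field K]
variable {G : Type*} [AddCommGroup G] [Module K G]
variable {H : Type*} [AddCommGroup H] [Module K H]

/-- The bracket `br` makes the graded vector space `(G, 𝒢)` a symmetric graded Lie algebra. -/
structure IsSymmGradedLie (𝒢 : ℤ → Submodule K G) (br : G →ₗ[K] G →ₗ[K] G) : Prop where
  isInternal : DirectSum.IsInternal 𝒢
  degree : ∀ (i j : ℤ) (x y : G), x ∈ 𝒢 i → y ∈ 𝒢 j → br x y ∈ 𝒢 (i + j + 1)
  symm : ∀ (i j : ℤ) (x y : G), x ∈ 𝒢 i → y ∈ 𝒢 j → br x y = (i * j).negOnePow • br y x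
  leibniz : ∀ (i j k : ℤ) (x y z : G), x ∈ 𝒢 i → y ∈ 𝒢 j → z ∈ 𝒢 k →
    br x (br y z) =
      (i + 1).negOnePow • br (br x y) z + ((i + 1) * (j + 1)).negOnePow • br y (br x z)

/-- `Homⁿ(H, H)`: `D` is a linear endomorphism of degree `n`. -/
def HasDegree (ℋ : ℤ → Submodule K H) (n : ℤ) (D : Module.End K H) : Prop :=
  ∀ (i : ℤ) (x : H), x ∈ ℋ i → D x ∈ ℋ (i + n)

/-- `Derⁿ(H)`: `D` is a derivation of degree `n` of the symmetric graded Lie algebra `H`. -/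
structure IsDerivation (ℋ : ℤ → Submodule K H) (br : H →ₗ[K] H →ₗ[K] H) (n : ℤ)
    (D : Module.End K H) : Prop where
  degree : HasDegree ℋ n D
  map_bracket : ∀ (i j : ℤ) (x y : H), x ∈ ℋ i → y ∈ ℋ j →
    D (br x y) = n.negOnePow • br (D x) y + (n * (i + 1)).negOnePow • br x (D y)

/-- The graded commutator of endomorphisms `f`, `g` of degrees `m`, `n`. -/
def gradedCommutator (m n : ℤ) (f g : Module.End K H) : Module.End K H :=
  f * g - (m * n).negOnePow • (g * f)

/-- The bracket `[s⁻¹f, s⁻¹g] = (-1)ᵐ s⁻¹[f, g]` of the symmetric graded Lie algebra `s⁻¹ gl(H)`,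
for `f`, `g` of degrees `m`, `n` in `gl(H)`; the desuspension `s⁻¹` is the identity on underlying
vectors. -/
def desuspBracket (m n : ℤ) (f g : Module.End K H) : Module.End K H :=
  m.negOnePow • gradedCommutator m n f g

/-- `ρ` is an action of the symmetric graded Lie algebra `G` on the symmetric graded Lie algebra
`H`: a map of degree `1` into the derivations of `H` such that `s⁻¹ ∘ ρ` preserves brackets. An
action on a graded vector space `V` is the case of the abelian Lie algebra `V`, with bracket `0`. -/
structure IsAction (𝒢 : ℤ → Submodule K G) (brG : G →ₗ[K] G →ₗ[K] G)
    (ℋ : ℤ → Submodule K H) (brH : H →ₗ[K] H →ₗ[K] H) (ρ : G →ₗ[K] Module.End K H) : Prop where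
  isDerivation : ∀ (i : ℤ) (x : G), x ∈ 𝒢 i → IsDerivation ℋ brH (i + 1) (ρ x)
  map_bracket : ∀ (i j : ℤ) (x y : G), x ∈ 𝒢 i → y ∈ 𝒢 j →
    ρ (brG x y) = desuspBracket (i + 1) (j + 1) (ρ x) (ρ y)

/-- `T = ∑ Tₖ ∈ Homⁿ(S(H), G)`, where `Tₖ ∈ Hom(Sᵏ(H), G)` is given as a graded symmetric
multilinear map of `k` variables. -/
structure IsSymmHom (ℋ : ℤ → Submodule K H) (𝒢 : ℤ → Submodule K G) (n : ℤ)
    (T : ∀ k : ℕ, MultilinearMap K (fun _ : Fin k => H) G) : Prop where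
  degree : ∀ (k : ℕ) (d : Fin k → ℤ) (v : Fin k → H), (∀ i, v i ∈ ℋ (d i)) →
    T k v ∈ 𝒢 ((∑ i, d i) + n)
  symm : ∀ (k : ℕ) (d : Fin k → ℤ) (v : Fin k → H), (∀ i, v i ∈ ℋ (d i)) →
    ∀ σ : Equiv.Perm (Fin k), T k v = koszulSign d σ • T k (v ∘ σ)

/-- The sum `∑_{i<j} (-1)^{vᵢ(v₁+⋯+vᵢ₋₁)+vⱼ(v₁+⋯+vⱼ₋₁)+vᵢvⱼ} T_{p-1}(λ[vᵢ,vⱼ], v₁,…,v̂ᵢ,…,v̂ⱼ,…,vₚ)`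
for homogeneous `vᵢ` of degrees `dᵢ`. It is empty for `p ≤ 1`; for `p = q + 2` the smaller index
is written as `i.castSucc` with `i : Fin (q + 1)`. -/
def weightTerm (lam : K) (brH : H →ₗ[K] H →ₗ[K] H)
    (T : ∀ k : ℕ, MultilinearMap K (fun _ : Fin k => H) G) :
    (p : ℕ) → (Fin p → ℤ) → (Fin p → H) → G
  | 0, _, _ => 0
  | 1, _, _ => 0
  | q + 2, d, v =>
    ∑ j : Fin (q + 2), ∑ i : Fin (q + 1),
      if i.castSucc < j then
        (d i.castSucc * (∑ m ∈ Finset.Iio i.castSucc, d m) + d j * (∑ m ∈ Finset.Iio j, d m)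
            + d i.castSucc * d j).negOnePow •
          T (q + 1) (Fin.cons (lam • brH (v i.castSucc) (v j)) (i.removeNth (j.removeNth v)))
      else 0

/-- `T` is a homotopy `𝒪`-operator of weight `lam` on the symmetric graded Lie algebra `G` with
respect to the action `ρ` of `G` on the symmetric graded Lie algebra `H`. In the sum over
`(l, 1, p - l - 1)`-shuffles `k = p + 1 - l`; in the last sum `a = k - 1` and `l = p - a`. -/
structure IsHomotopyOOperator (lam : K) (𝒢 : ℤ → Submodule K G) (brG : G →ₗ[K] G →ₗ[K] G)
    (ℋ : ℤ → Submodule K H) (brH : H →ₗ[K] H →ₗ[K] H) (ρ : G →ₗ[K] Module.End K H)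
    (T : ∀ k : ℕ, MultilinearMap K (fun _ : Fin k => H) G) : Prop where
  isSymmHom : IsSymmHom ℋ 𝒢 0 T
  identity : ∀ (p : ℕ) (d : Fin p → ℤ) (v : Fin p → H), (∀ i, v i ∈ ℋ (d i)) →
    weightTerm lam brH T p d v
      + ∑ l : Fin p, ∑ σ ∈ shuffles₃ p l, koszulSign d σ •
          T (p - l - 1 + 1) (Fin.cons
            (ρ (T l (block (v ∘ σ) 0 l (by omega))) (v (σ l)))
            (block (v ∘ σ) (l + 1) (p - l - 1) (by omega)))
    = (2 : K)⁻¹ • ∑ a : Fin (p + 1), ∑ σ ∈ shuffles₂ p a, koszulSign d σ •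
          brG (T a (block (v ∘ σ) 0 a (by omega)))
            (T (p - a) (block (v ∘ σ) a (p - a) (by omega)))

/-- The operations `θ₁, θ₂, …`, where `θ k` is the operation `θ_{k+1}` with `k + 1` inputs, make the
graded vector space `(H, ℋ)` a pre-Lie_∞ algebra. The `n = p + 1` inputs are written as
`v₁, …, vₚ` and a last input `w`. In the first sum of `identity`, `l = i - 1` and `j = p + 1 - l`;
in the second one, `a = j - 1` and `i = p - a + 1`. -/
structure IsPreLieInfinity (ℋ : ℤ → Submodule K H)
    (θ : ∀ k : ℕ, MultilinearMap K (fun _ : Fin (k + 1) => H) H) : Prop where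
  isInternal : DirectSum.IsInternal ℋ
  degree : ∀ (k : ℕ) (d : Fin (k + 1) → ℤ) (v : Fin (k + 1) → H), (∀ i, v i ∈ ℋ (d i)) →
    θ k v ∈ ℋ ((∑ i, d i) + 1)
  symm : ∀ (p : ℕ) (d : Fin p → ℤ) (v : Fin p → H) (e : ℤ) (w : H),
    (∀ i, v i ∈ ℋ (d i)) → w ∈ ℋ e → ∀ σ : Equiv.Perm (Fin p),
      θ p (Fin.snoc v w) = koszulSign d σ • θ p (Fin.snoc (v ∘ σ) w)
  identity : ∀ (p : ℕ) (d : Fin p → ℤ) (v : Fin p → H) (e : ℤ) (w : H),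
    (∀ i, v i ∈ ℋ (d i)) → w ∈ ℋ e →
      ∑ l : Fin p, ∑ σ ∈ shuffles₃ p l, koszulSign d σ •
          θ (p - l - 1 + 1) (Fin.snoc (Fin.cons
            (θ l (block (v ∘ σ) 0 (l + 1) (by omega)))
            (block (v ∘ σ) (l + 1) (p - l - 1) (by omega)) : Fin (p - l - 1 + 1) → H) w)
      + ∑ a : Fin (p + 1), ∑ σ ∈ shuffles₂ p a,
          (∑ i, block (d ∘ σ) 0 a (by omega) i).negOnePow • koszulSign d σ •
          θ a (Fin.snoc (block (v ∘ σ) 0 a (by omega))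
            (θ (p - a) (Fin.snoc (block (v ∘ σ) a (p - a) (by omega)) w)))
      = 0

/-- The operation `θ_{k+1}(v₁, …, v_{k+1}) = ρ(T_k(v₁, …, v_k)) v_{k+1}`. -/
def inducedOp (ρ : G →ₗ[K] Module.End K H)
    (T : ∀ k : ℕ, MultilinearMap K (fun _ : Fin k => H) G) (k : ℕ) :
    MultilinearMap K (fun _ : Fin (k + 1) => H) H :=
  MultilinearMap.uncurryRight (ρ.compMultilinearMap (T k))

end Graded

end HomotopyOp

namespace HomotopyOp

/-! ### Interchanging the two blocks of a shuffle -/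

/-! Apply `ρ` to the operator identity for `v₁, …, vₚ` and evaluate at the last input `w`. The
left-hand side becomes the first sum of the pre-Lie_∞ identity. Let `A` and `B` be the degrees of
the two blocks of a shuffle. Since `T` has degree `0`, the action axiom turns `ρ[T_a, T_b] w` into
minus the sum of `(-1)^A ρ(T_a) ρ(T_b) w` and `(-1)^(AB+B) ρ(T_b) ρ(T_a) w`. Interchanging the
blocks costs exactly the Koszul sign `(-1)^(AB)`, so after summation over all shuffles both terms
give the same total (`sum_sum_shuffles₂_swap`). The factor `1/2` therefore disappears, and what
remains is minus the second sum of the pre-Lie_∞ identity. -/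

/-- The permutation of positions that moves the first `a` positions behind the last `b` ones. -/
def blockSwap (a b : ℕ) : Equiv.Perm (Fin (a + b)) :=
  finAddFlip.trans (finCongr (Nat.add_comm b a))

theorem blockSwap_castAdd (a b : ℕ) (i : Fin a) :
    (blockSwap a b (Fin.castAdd b i) : ℕ) = b + i := by
  simp [blockSwap, Nat.add_comm]

theorem blockSwap_natAdd (a b : ℕ) (j : Fin b) :
    (blockSwap a b (Fin.natAdd a j) : ℕ) = j := by
  simp [blockSwap]

theorem blockSwap_val (a b : ℕ) (x : Fin (a + b)) :
    (blockSwap a b x : ℕ) = if (x : ℕ) < a then b + x else x - a := by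
  induction x using Fin.addCases with
  | left i => simp [blockSwap_castAdd]
  | right j => simp [blockSwap_natAdd]

/-- `blockSwap a b` is increasing on each block and carries the two blocks cut at `a` to those cut
at `b`, so both conditions concern the same pairs of positions. -/
theorem isShuffle_mul_blockSwap_symm {a b : ℕ} (σ : Equiv.Perm (Fin (a + b))) :
    IsShuffle {b} (σ * (blockSwap a b).symm) ↔ IsShuffle {a} σ := by
  unfold IsShuffle
  rw [← (blockSwap a b).forall_congr_right]
  refine forall_congr' fun i => ?_
  rw [← (blockSwap a b).forall_congr_right]
  refine forall_congr' fun j => ?_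
  simp only [Equiv.Perm.mul_apply, Equiv.symm_apply_apply, Finset.mem_singleton, forall_eq,
    Fin.lt_def (a := blockSwap a b i), Fin.lt_def (a := i), blockSwap_val, ← and_imp]
  have hi := i.isLt
  have hj := j.isLt
  refine imp_congr_left ?_
  split_ifs <;> omega

/-- Pairs within a block contribute equally on both sides. A pair from different blocks is out of
order for exactly one of the two permutations, so its sign is the discrepancy. -/
theorem koszulSign_mul_blockSwap_symm {a b : ℕ} (d : Fin (a + b) → ℤ)
    (σ : Equiv.Perm (Fin (a + b))) :
    koszulSign d (σ * (blockSwap a b).symm) =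
      ((∑ i, d (σ (Fin.castAdd b i))) * ∑ j, d (σ (Fin.natAdd a j))).negOnePow *
        koszulSign d σ := by
  -- The sign of the interchange splits into the cross-block pairs that `σ` inverts and those that
  -- it keeps in order.
  have key : ((∑ i, d (σ (Fin.castAdd b i))) * ∑ j, d (σ (Fin.natAdd a j))).negOnePow =
      (∏ i : Fin a, ∏ j : Fin b, if σ (Fin.natAdd a j) < σ (Fin.castAdd b i) then
        (d (σ (Fin.castAdd b i)) * d (σ (Fin.natAdd a j))).negOnePow else 1) *
      ∏ j : Fin b, ∏ i : Fin a, if σ (Fin.castAdd b i) < σ (Fin.natAdd a j) then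
        (d (σ (Fin.natAdd a j)) * d (σ (Fin.castAdd b i))).negOnePow else 1 := by
    have hsum : ∀ {n : ℕ} (f : Fin n → ℤ), (∑ i, f i).negOnePow = ∏ i, (f i).negOnePow := by
      intro n f
      induction n with
      | zero => simp
      | succ n ih => rw [Fin.sum_univ_succ, Fin.prod_univ_succ, Int.negOnePow_add, ih]
    rw [Finset.sum_mul_sum, hsum]
    simp_rw [hsum]
    rw [Finset.prod_comm (s := (Finset.univ : Finset (Fin b))), ← Finset.prod_mul_distrib]
    refine Finset.prod_congr rfl fun i _ => ?_
    rw [← Finset.prod_mul_distrib]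
    refine Finset.prod_congr rfl fun j _ => ?_
    have hne : σ (Fin.castAdd b i) ≠ σ (Fin.natAdd a j) := fun h => by
      have := congrArg Fin.val (σ.injective h)
      simp at this
      omega
    rcases lt_or_gt_of_ne hne with h | h
    · simp [h, h.not_gt, mul_comm]
    · simp [h, h.not_gt]
  have hlt₁ (i : Fin a) (j : Fin b) : Fin.castAdd b i < Fin.natAdd a j := by
    simp [Fin.lt_def]; omega
  have hlt₂ (i : Fin a) (j : Fin b) :
      blockSwap a b (Fin.natAdd a j) < blockSwap a b (Fin.castAdd b i) := by
    rw [Fin.lt_def, blockSwap_castAdd, blockSwap_natAdd]; omega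
  have hl (i j : Fin a) : blockSwap a b (Fin.castAdd b i) < blockSwap a b (Fin.castAdd b j) ↔
      Fin.castAdd b i < Fin.castAdd b j := by
    simp only [Fin.lt_def, blockSwap_castAdd, Fin.val_castAdd]; omega
  have hr (i j : Fin b) : blockSwap a b (Fin.natAdd a i) < blockSwap a b (Fin.natAdd a j) ↔
      Fin.natAdd a i < Fin.natAdd a j := by
    simp only [Fin.lt_def, blockSwap_natAdd, Fin.val_natAdd]; omega
  rw [key]
  unfold koszulSign
  have hre (f : Fin (a + b) → Fin (a + b) → ℤˣ) :
      ∏ i, ∏ j, f i j = ∏ i, ∏ j, f (blockSwap a b i) (blockSwap a b j) := by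
    rw [← Equiv.prod_comp (blockSwap a b)]
    exact Finset.prod_congr rfl fun i _ => (Equiv.prod_comp (blockSwap a b) _).symm
  rw [hre]
  simp only [Equiv.Perm.mul_apply, Equiv.symm_apply_apply, Fin.prod_univ_add,
    Finset.prod_mul_distrib, hl, hr, hlt₁, hlt₂, (hlt₁ _ _).not_gt, (hlt₂ _ _).not_gt, true_and,
    false_and, if_false, Finset.prod_const_one, one_mul, mul_one]
  -- `x` and `y` come from pairs inside the blocks, `z` from cross pairs inverted by `σ`, `q` from
  -- the other cross pairs; `z` occurs twice on the right and squares to `1`.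
  have cancel (x y z q : ℤˣ) : x * q * y = z * q * (x * (z * y)) := by
    calc x * q * y = z * z * (x * q * y) := by rw [Int.units_mul_self, one_mul]
      _ = z * q * (x * (z * y)) := by ac_rfl
  exact cancel _ _ _ _

theorem block_comp_mul_blockSwap_symm_fst {α : Type*} {a b : ℕ} (u : Fin (a + b) → α)
    (σ : Equiv.Perm (Fin (a + b))) :
    block (u ∘ (σ * (blockSwap a b).symm)) 0 b (by omega) = block (u ∘ σ) a b le_rfl := by
  funext j
  simp only [block, Function.comp_apply, Equiv.Perm.mul_apply]
  congr 2
  rw [Equiv.symm_apply_eq]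
  ext
  rw [blockSwap_val]
  simp

theorem block_comp_mul_blockSwap_symm_snd {α : Type*} {a b : ℕ} (u : Fin (a + b) → α)
    (σ : Equiv.Perm (Fin (a + b))) :
    block (u ∘ (σ * (blockSwap a b).symm)) b a (by omega) =
      block (u ∘ σ) 0 a (by omega) := by
  funext j
  simp only [block, Function.comp_apply, Equiv.Perm.mul_apply]
  congr 2
  rw [Equiv.symm_apply_eq]
  ext
  rw [blockSwap_val]
  simp

/-- Interchanging the two blocks of a shuffle in a sum with Koszul signs. -/
theorem sum_shuffles₂_swap {α M : Type*} [AddCommGroup M] {p a b : ℕ} (hab : a + b = p)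
    (d : Fin p → ℤ) (v : Fin p → α)
    (F : (Fin b → ℤ) → (Fin a → ℤ) → (Fin b → α) → (Fin a → α) → M) :
    ∑ σ ∈ shuffles₂ p b, koszulSign d σ •
        F (block (d ∘ σ) 0 b (by omega)) (block (d ∘ σ) b a (by omega))
          (block (v ∘ σ) 0 b (by omega)) (block (v ∘ σ) b a (by omega)) =
      ∑ σ ∈ shuffles₂ p a, koszulSign d σ •
        ((∑ i, block (d ∘ σ) 0 a (by omega) i) *
            ∑ i, block (d ∘ σ) a b (by omega) i).negOnePow •
          F (block (d ∘ σ) a b (by omega)) (block (d ∘ σ) 0 a (by omega))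
            (block (v ∘ σ) a b (by omega)) (block (v ∘ σ) 0 a (by omega)) := by
  subst hab
  symm
  refine Finset.sum_equiv (Equiv.mulRight (blockSwap a b).symm) (fun σ => ?_) fun σ _ => ?_
  · simp [shuffles₂, isShuffle_mul_blockSwap_symm]
  · simp only [Equiv.coe_mulRight, block_comp_mul_blockSwap_symm_fst,
      block_comp_mul_blockSwap_symm_snd, koszulSign_mul_blockSwap_symm, mul_comm _ (koszulSign d σ),
      mul_smul, block, Function.comp_apply]
    simp only [Nat.zero_add]
    rfl

/-- Interchanging the two blocks of all shuffles in a sum with Koszul signs. -/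
theorem sum_sum_shuffles₂_swap {α M : Type*} [AddCommGroup M] {p : ℕ}
    (d : Fin p → ℤ) (v : Fin p → α)
    (F : ∀ a b : ℕ, (Fin a → ℤ) → (Fin b → ℤ) → (Fin a → α) → (Fin b → α) → M) :
    ∑ a : Fin (p + 1), ∑ σ ∈ shuffles₂ p a, koszulSign d σ •
        F a (p - a) (block (d ∘ σ) 0 a (by omega)) (block (d ∘ σ) a (p - a) (by omega))
          (block (v ∘ σ) 0 a (by omega)) (block (v ∘ σ) a (p - a) (by omega)) =
      ∑ a : Fin (p + 1), ∑ σ ∈ shuffles₂ p a, koszulSign d σ •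
        ((∑ i, block (d ∘ σ) 0 a (by omega) i) *
            ∑ i, block (d ∘ σ) a (p - a) (by omega) i).negOnePow •
          F (p - a) a (block (d ∘ σ) a (p - a) (by omega)) (block (d ∘ σ) 0 a (by omega))
            (block (v ∘ σ) a (p - a) (by omega)) (block (v ∘ σ) 0 a (by omega)) := by
  rw [← Equiv.sum_comp Fin.revPerm]
  refine Finset.sum_congr rfl fun a _ => ?_
  -- The lengths `b` and `c` are kept as variables because `p - (p - a)` and `a` are not
  -- definitionally equal, while the types of the blocks depend on them.
  have key : ∀ b c : ℕ, ∀ h : b + c = p, b = p - a → c = a →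
      ∑ σ ∈ shuffles₂ p b, koszulSign d σ •
        F b c (block (d ∘ σ) 0 b (by omega)) (block (d ∘ σ) b c h.le)
          (block (v ∘ σ) 0 b (by omega)) (block (v ∘ σ) b c h.le) =
      ∑ σ ∈ shuffles₂ p a, koszulSign d σ •
        ((∑ i, block (d ∘ σ) 0 a (by omega) i) *
            ∑ i, block (d ∘ σ) a (p - a) (by omega) i).negOnePow •
          F (p - a) a (block (d ∘ σ) a (p - a) (by omega)) (block (d ∘ σ) 0 a (by omega))
            (block (v ∘ σ) a (p - a) (by omega)) (block (v ∘ σ) 0 a (by omega)) := by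
    rintro _ _ h rfl rfl
    exact sum_shuffles₂_swap (by omega) d v (F (p - a) a)
  refine key _ _ ?_ ?_ ?_ <;> simp only [Fin.revPerm_apply, Fin.val_rev] <;> omega

/-! ### From the operator identity to the pre-Lie_∞ identity -/

section Graded

variable {K : Type*} [Field K]
variable {G : Type*} [AddCommGroup G] [Module K G]
variable {H : Type*} [AddCommGroup H] [Module K H]

theorem inducedOp_apply (ρ : G →ₗ[K] Module.End K H)
    (T : ∀ k : ℕ, MultilinearMap K (fun _ : Fin k => H) G) (k : ℕ) (v : Fin (k + 1) → H) :
    inducedOp ρ T k v = ρ (T k (Fin.init v)) (v (Fin.last k)) :=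
  rfl

theorem inducedOp_snoc (ρ : G →ₗ[K] Module.End K H)
    (T : ∀ k : ℕ, MultilinearMap K (fun _ : Fin k => H) G) (k : ℕ) (v : Fin k → H) (w : H) :
    inducedOp ρ T k (Fin.snoc v w) = ρ (T k v) w := by
  rw [inducedOp_apply, Fin.init_snoc (α := fun _ => H), Fin.snoc_last (α := fun _ => H)]

theorem weightTerm_zero_bracket (lam : K)
    (T : ∀ k : ℕ, MultilinearMap K (fun _ : Fin k => H) G) (p : ℕ) (d : Fin p → ℤ)
    (v : Fin p → H) : weightTerm lam 0 T p d v = 0 := by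
  match p with
  | 0 => rfl
  | 1 => rfl
  | q + 2 =>
    refine Finset.sum_eq_zero fun j _ => Finset.sum_eq_zero fun i _ => ?_
    split_ifs
    · rw [(T (q + 1)).map_coord_zero 0 (by simp), smul_zero]
    · rfl

/-- An action on a bracket, with the signs in terms of the degrees of the two arguments. -/
theorem IsAction.map_bracket_apply {𝒢 : ℤ → Submodule K G} {brG : G →ₗ[K] G →ₗ[K] G}
    {ℋ : ℤ → Submodule K H} {brH : H →ₗ[K] H →ₗ[K] H} {ρ : G →ₗ[K] Module.End K H}
    (hρ : IsAction 𝒢 brG ℋ brH ρ) {i j : ℤ} {x y : G} (hx : x ∈ 𝒢 i) (hy : y ∈ 𝒢 j) (w : H) :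
    ρ (brG x y) w =
      -(i.negOnePow • ρ x (ρ y w) + (i * j).negOnePow • j.negOnePow • ρ y (ρ x w)) := by
  -- The exponents `(i + 1)(j + 2)` and `(i + 1)j` differ by `2(i + 1)`.
  have hsign : (i + 1).negOnePow * ((i + 1) * (j + 1)).negOnePow =
      (i * j).negOnePow * j.negOnePow := by
    rw [← Int.negOnePow_add, ← Int.negOnePow_add, Int.negOnePow_eq_iff]
    exact ⟨i + 1, by ring⟩
  rw [hρ.map_bracket i j x y hx hy]
  simp only [desuspBracket, gradedCommutator, LinearMap.smul_apply, LinearMap.sub_apply,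
    Module.End.mul_apply, smul_sub, smul_smul, hsign]
  rw [Int.negOnePow_succ, Units.neg_smul]
  abel

end Graded

end HomotopyOp

theorem mainTheorem7 {K : Type*} [Field K] [CharZero K]
    {G : Type*} [AddCommGroup G] [Module K G] (𝒢 : ℤ → Submodule K G) (brG : G →ₗ[K] G →ₗ[K] G)
    (hG : HomotopyOp.IsSymmGradedLie 𝒢 brG)
    {V : Type*} [AddCommGroup V] [Module K V] (𝒱 : ℤ → Submodule K V)
    (hV : DirectSum.IsInternal 𝒱)
    (ρ : G →ₗ[K] Module.End K V) (hρ : HomotopyOp.IsAction 𝒢 brG 𝒱 0 ρ)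
    (T : ∀ k : ℕ, MultilinearMap K (fun _ : Fin k => V) G)
    (hT : HomotopyOp.IsHomotopyOOperator (0 : K) 𝒢 brG 𝒱 0 ρ T) :
    HomotopyOp.IsPreLieInfinity 𝒱 (HomotopyOp.inducedOp ρ T) ∧
      ∀ (k : ℕ) (v : Fin (k + 1) → V),
        HomotopyOp.inducedOp ρ T k v = ρ (T k (Fin.init v)) (v (Fin.last k)) := by
  open HomotopyOp in
  refine ⟨⟨hV, fun k d v hv => ?_, fun p d v e w hv hw σ => ?_, fun p d v e w hv hw => ?_⟩,
    inducedOp_apply ρ T⟩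
  · have hTk := hT.isSymmHom.degree k (Fin.init d) (Fin.init v) fun i => hv _
    have h := (hρ.isDerivation _ _ hTk).degree _ _ (hv (Fin.last k))
    rw [inducedOp_apply, Fin.sum_univ_castSucc]
    convert h using 2
    simp only [Fin.init]
    ring
  · rw [inducedOp_snoc, inducedOp_snoc, hT.isSymmHom.symm p d v hv σ, Units.smul_def, map_zsmul]
    rfl
  · have hdeg (σ : Equiv.Perm (Fin p)) (s m : ℕ) (h : s + m ≤ p) :
        T m (block (v ∘ σ) s m h) ∈ 𝒢 (∑ i, block (d ∘ σ) s m h i) := by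
      simpa using hT.isSymmHom.degree m (block (d ∘ σ) s m h) (block (v ∘ σ) s m h) fun i => hv _
    have hid := congrArg (fun x => ρ x w) (hT.identity p d v hv)
    -- The summand depends on the degrees of the first block, hence the degree arguments of `F`. The
    -- right-hand side has the signs of the second term of `IsAction.map_bracket_apply`, so
    -- rewriting backwards merges it with the first.
    have hswap := sum_sum_shuffles₂_swap d v fun a b d₁ _ v₁ v₂ =>
      (∑ i, d₁ i).negOnePow • ρ (T a v₁) (ρ (T b v₂) w)
    have hu (u : ℤˣ) (x : G) : ρ (u • x) w = u • ρ x w := by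
      rw [Units.smul_def, map_zsmul]
      rfl
    simp only [weightTerm_zero_bracket, zero_add, map_sum, LinearMap.sum_apply, hu, map_smul,
      LinearMap.smul_apply, hρ.map_bracket_apply (hdeg _ _ _ _) (hdeg _ _ _ _), smul_neg, smul_add,
      Finset.sum_neg_distrib, Finset.sum_add_distrib, ← hswap] at hid
    simp only [inducedOp_snoc]
    -- The last of the `l + 1` entries sits at position `l`: it is the middle block of the `(l, 1, p
    -- - l - 1)`-shuffle.
    have hlast (l : Fin p) (σ : Equiv.Perm (Fin p)) :
        inducedOp ρ T l (block (v ∘ σ) 0 (l + 1) (by omega)) =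
          ρ (T l (block (v ∘ σ) 0 l (by omega))) (v (σ l)) := by
      rw [inducedOp_apply]
      congr 1
      simp [block]
    simp only [hlast, smul_comm (Int.negOnePow _) (koszulSign d _)]
    -- The two equal halves add up to `2⁻¹ + 2⁻¹ = 1`; characteristic zero enters only through `2 ≠
    -- 0`.
    rw [hid, ← add_smul, ← two_mul, mul_inv_cancel₀ two_ne_zero, one_smul, neg_add_cancel]
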